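/- Let $d\ge 1$ and let $\mathbb R_+=[0,\infty)$. For $s,t\in\mathbb R^d$ write $s\le t$ if $s_i\le t_i$ for all $i$, and set $[0,t]=\{s: 0\le s\le t\}$ and $[t,+\infty[=\{s: t\le s\}$. Let $\mathcal S(\mathbb R^d)$ be the space of real-valued Schwartz functions and $\mathcal S'(\mathbb R^d)$ its topological dual. Let $\nu$ be a Lévy measure on $\mathbb R\setminus\{0\}$ (that is, $\int (1\wedge x^2)\,\nu(dx)<\infty$), let $\eta>0$, and let $M$ be a Poisson random measure on $(\mathbb R\setminus\{0\})\times\mathbb R_+^d$, defined on a probability space $(\Omega,\mathcal F,\mathbb P)$, with intensity measure $\mathbf 1_{|x|>\eta}\,\nu(dx)\,dt$. Suppose that $\int_{|x|>\eta}|x|^\alpha\,\nu(dx)<\infty$ for some $\alpha>0$. Then, almost surely, the integrals $$P_t=\int_{[0,t]}\int_{|x|>\eta} x\,M(ds,dx),\qquad t\in\mathbb R_+^d,$$ converge absolutely (this defines the compound Poisson sheet $P$), and the following hold, all the integrals being absolutely convergent. (i) Almost surely, $M$ defines a tempered distribution by the formula $$\langle M,\varphi\rangle=\int_{\mathbb R_+^d}\int_{|x|>\eta}\varphi(t)\,x\,M(dt,dx),\qquad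 \varphi\in\mathcal S(\mathbb R^d).$$ (ii) Almost surely, $\varphi\mapsto\langle P,\varphi\rangle:=\int_{\mathbb R_+^d}P_t\,\varphi(t)\,dt$ is a tempered distribution, and for all $\varphi\in\mathcal S(\mathbb R^d)$, $$\langle P,\varphi\rangle=\int_{\mathbb R_+^d}\int_{|x|>\eta}\Big(\int_{[t,+\infty[}\varphi(s)\,ds\Big)\,x\,M(dt,dx).$$ (iii) Almost surely, $M=\dfrac{\partial^d P}{\partial t_1\cdots\partial t_d}$ in $\mathcal S'(\mathbb R^d)$, that is, $\langle M,\varphi\rangle=(-1)^d\Big\langle P,\dfrac{\partial^d\varphi}{\partial t_1\cdots\partial t_d}\Big\rangle$ for all $\varphi\in\mathcal S(\mathbb R^d)$. -/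

import Mathlib

open MeasureTheory ProbabilityTheory
open scoped ENNReal NNReal SchwartzMap LineDeriv

noncomputable section

namespace LevySheet

/-- A Lévy measure on `ℝ`: it does not charge the origin and `∫ (1 ∧ x²) ν(dx) < ∞`. -/
structure IsLevyMeasure (ν : Measure ℝ) : Prop where
  zero : ν {0} = 0
  lintegral_lt_top : ∫⁻ x, ENNReal.ofReal (min 1 (x ^ 2)) ∂ν < ∞

/-- The random measure `M` on `S`, defined on the probability space `(Ω, Pr)`, is a Poisson random
measure with intensity `μ`: it is measurable, its values on disjoint measurable sets are
independent, and `M B` has the Poisson law with parameter `μ B` for every measurable set `B` (with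
the usual convention that the Poisson law with parameter `∞` is the Dirac mass at `∞`). -/
structure IsPoissonRandomMeasure {Ω S : Type*} [MeasurableSpace Ω] [MeasurableSpace S]
    (M : Ω → Measure S) (μ : Measure S) (Pr : Measure Ω) : Prop where
  measurable : ∀ B : Set S, MeasurableSet B → Measurable (fun ω => M ω B)
  indep : ∀ (n : ℕ) (B : Fin n → Set S), (∀ i, MeasurableSet (B i)) →
    Pairwise (fun i j => Disjoint (B i) (B j)) → iIndepFun (fun i ω => M ω (B i)) Pr
  law : ∀ B : Set S, MeasurableSet B → μ B < ∞ →
    Pr.map (fun ω => M ω B) = (poissonMeasure (μ B).toNNReal).map (fun n : ℕ => (n : ℝ≥0∞))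
  law_top : ∀ B : Set S, MeasurableSet B → μ B = ∞ → ∀ᵐ ω ∂Pr, M ω B = ∞

/-- The set `ℝ₊ᵈ`. -/
def orthant (d : ℕ) : Set (EuclideanSpace ℝ (Fin d)) := {t | ∀ i, 0 ≤ t i}

/-- The box `[0, t]`. -/
def boxTo {d : ℕ} (t : EuclideanSpace ℝ (Fin d)) : Set (EuclideanSpace ℝ (Fin d)) :=
  {s | ∀ i, 0 ≤ s i ∧ s i ≤ t i}

/-- The set `[t, +∞[ = {s | t ≤ s}` (coordinatewise order). -/
def upperBox {d : ℕ} (t : EuclideanSpace ℝ (Fin d)) : Set (EuclideanSpace ℝ (Fin d)) :=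
  {s | ∀ i, t i ≤ s i}

/-- The jump sizes `|x| > η`. -/
def largeJumps (η : ℝ) : Set ℝ := {x | η < |x|}

/-- The measure `1_{|x| > η} ν(dx) dt` on jump sizes and times; `dt` is Lebesgue measure
on `ℝ₊ᵈ`. -/
def intensity (d : ℕ) (η : ℝ) (ν : Measure ℝ) : Measure (ℝ × EuclideanSpace ℝ (Fin d)) :=
  (ν.restrict (largeJumps η)).prod (volume.restrict (orthant d))

/-- The compound Poisson sheet `P_t = ∫_{[0,t]} ∫_{|x| > η} x m(dx, ds)` of a realization `m` of
the random measure. -/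
def sheet {d : ℕ} (η : ℝ) (m : Measure (ℝ × EuclideanSpace ℝ (Fin d)))
    (t : EuclideanSpace ℝ (Fin d)) : ℝ :=
  ∫ p in largeJumps η ×ˢ boxTo t, p.1 ∂m

/-- Tempered distributions on `ℝᵈ`: the continuous linear functionals on the real Schwartz
space. -/
abbrev Tempered (d : ℕ) : Type := 𝓢(EuclideanSpace ℝ (Fin d), ℝ) →L[ℝ] ℝ

/-- The mixed derivative `∂ᵈT/∂t₁⋯∂t_d` of a tempered distribution,
`φ ↦ (-1)ᵈ ⟨T, ∂ᵈφ/∂t₁⋯∂t_d⟩`. -/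
def mixedDeriv {d : ℕ} (T : Tempered d) : Tempered d :=
  (-1 : ℝ) ^ d • T.comp
    (LineDeriv.iteratedLineDerivOpCLM ℝ 𝓢(EuclideanSpace ℝ (Fin d), ℝ)
      (fun i : Fin d => EuclideanSpace.single i (1 : ℝ)))

end LevySheet

end

/-!
The proof reduces everything to one almost sure estimate and then argues realization by
realization.

The estimate (`LevySheet.ae_integrable_weight`): for some `N`, almost every realization integrates
`(1 + ‖t‖)⁻ᴺ` and `|x| (1 + ‖t‖)⁻ᴺ`. Choose `K` with `d < K α`. By Markov's inequality the points
with `|x| > (1 + ‖t‖)ᴷ` have finite intensity. Since the random measure takes integer values on sets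
of finite intensity, among these points almost surely none has `|x|` beyond some (random) bound `k`.
Hence `|x| ≤ (k + 1) (1 + ‖t‖)ᴷ` almost everywhere for the realization, and
`(1 + ‖t‖)^(-(d + 1))` is integrable by Campbell's formula. The argument never sums the jumps over a
box in the mean, so that it also covers `α < 1`, where `|x|` need not be `ν`-integrable.

For a fixed realization with this property, both `M` and the sheet `P` are densities integrable
against a polynomially decaying weight (`|P t|` is at most a constant times `(1 + ‖t‖)ᴺ`), hence
tempered distributions (`LevySheet.exists_tempered_integral`). The formula for `⟨P, φ⟩` is Fubini's
theorem, `s ∈ [0, t]` being the same as `t ∈ [s, +∞[` (`LevySheet.integral_sheet_mul`). Finally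
`∫_{[t, +∞[} ∂ᵈφ/∂t₁⋯∂t_d = (-1)ᵈ φ(t)`, by induction on `d`
(`LevySheet.setIntegral_upperBox_mixed`), turns this formula into `M = ∂ᵈP/∂t₁⋯∂t_d`.
-/

namespace LevySheet

/-! ### Campbell's formula -/

lemma lintegral_natCast_poissonMeasure (r : ℝ≥0) :
    ∫⁻ n : ℕ, (n : ℝ≥0∞) ∂(poissonMeasure r) = r := by
  have hstep (n : ℕ) : ((n + 1 : ℕ) : ℝ≥0∞) * poissonMeasure r {n + 1}
      = r * poissonMeasure r {n} := by
    rw [poissonMeasure_singleton, poissonMeasure_singleton, ← ENNReal.ofReal_natCast,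
      ← ENNReal.ofReal_coe_nnreal, ← ENNReal.ofReal_mul (by positivity),
      ← ENNReal.ofReal_mul (by positivity)]
    congr 1
    rw [Nat.factorial_succ]
    push_cast
    have h1 : (n : ℝ) + 1 ≠ 0 := by positivity
    have h2 : (n.factorial : ℝ) ≠ 0 := by positivity
    field_simp
    ring
  have hone : ∑' n : ℕ, poissonMeasure r {n} = 1 := by
    have h := lintegral_countable' (μ := poissonMeasure r) (fun _ : ℕ => (1 : ℝ≥0∞))
    simpa using h.symm
  rw [lintegral_countable', tsum_eq_zero_add' ENNReal.summable]
  simp only [hstep, ENNReal.tsum_mul_left, hone]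
  simp

namespace IsPoissonRandomMeasure

variable {Ω S : Type*} [MeasurableSpace Ω] [MeasurableSpace S] {M : Ω → Measure S}
  {μ : Measure S} {Pr : Measure Ω}

lemma measurable_measure (hM : IsPoissonRandomMeasure M μ Pr) : Measurable M :=
  Measure.measurable_of_measurable_coe M hM.measurable

lemma lintegral_apply [IsProbabilityMeasure Pr] (hM : IsPoissonRandomMeasure M μ Pr) {B : Set S}
    (hB : MeasurableSet B) : ∫⁻ ω, M ω B ∂Pr = μ B := by
  rcases eq_or_ne (μ B) ∞ with h | h
  · rw [lintegral_congr_ae (hM.law_top B hB h), h]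
    simp
  · have h1 : ∫⁻ ω, M ω B ∂Pr = ∫⁻ y, y ∂(Pr.map fun ω => M ω B) :=
      (lintegral_map measurable_id (hM.measurable B hB)).symm
    rw [h1, hM.law B hB h.lt_top,
      lintegral_map (f := fun y => y) measurable_id (measurable_of_countable _)]
    exact (lintegral_natCast_poissonMeasure _).trans (ENNReal.coe_toNNReal h)

/-- Campbell's formula: the mean of the random measure is its intensity. -/
lemma lintegral_lintegral [IsProbabilityMeasure Pr] (hM : IsPoissonRandomMeasure M μ Pr)
    {f : S → ℝ≥0∞} (hf : Measurable f) :
    ∫⁻ ω, ∫⁻ p, f p ∂(M ω) ∂Pr = ∫⁻ p, f p ∂μ := by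
  have hbind : Pr.bind M = μ := by
    ext B hB
    rw [Measure.bind_apply hB hM.measurable_measure.aemeasurable, hM.lintegral_apply hB]
  rw [← hbind, Measure.lintegral_bind hM.measurable_measure.aemeasurable hf.aemeasurable]

lemma ae_lintegral_lt_top [IsProbabilityMeasure Pr] (hM : IsPoissonRandomMeasure M μ Pr)
    {f : S → ℝ≥0∞} (hf : Measurable f) (hfin : ∫⁻ p, f p ∂μ ≠ ∞) :
    ∀ᵐ ω ∂Pr, ∫⁻ p, f p ∂(M ω) < ∞ :=
  ae_lt_top ((Measure.measurable_lintegral hf).comp hM.measurable_measure)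
    (by rwa [hM.lintegral_lintegral hf])

/-- The number of points in a set of finite intensity is almost surely a natural number. -/
lemma ae_exists_natCast (hM : IsPoissonRandomMeasure M μ Pr) {B : Set S} (hB : MeasurableSet B)
    (hfin : μ B < ∞) : ∀ᵐ ω ∂Pr, ∃ n : ℕ, M ω B = n := by
  have hmeas : MeasurableSet (Set.range fun n : ℕ => (n : ℝ≥0∞)) :=
    (Set.countable_range _).measurableSet
  have h : ∀ᵐ y ∂(Pr.map fun ω => M ω B), y ∈ Set.range fun n : ℕ => (n : ℝ≥0∞) := by
    rw [hM.law B hB hfin]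
    exact (ae_map_iff (measurable_of_countable _).aemeasurable hmeas).2
      (Filter.Eventually.of_forall fun n => ⟨n, rfl⟩)
  filter_upwards [(ae_map_iff (hM.measurable B hB).aemeasurable hmeas).1 h] with ω hω
  obtain ⟨n, hn⟩ := hω
  exact ⟨n, hn.symm⟩

/-- Along a sequence of sets of finite intensity decreasing to the empty set, the random measure
almost surely vanishes from some index on: its values are integers and tend to `0`. -/
lemma ae_exists_apply_eq_zero (hM : IsPoissonRandomMeasure M μ Pr) {B : ℕ → Set S}
    (hB : ∀ k, MeasurableSet (B k)) (hanti : Antitone B) (hempty : ⋂ k, B k = ∅)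
    (hfin : μ (B 0) < ∞) : ∀ᵐ ω ∂Pr, ∃ k, M ω (B k) = 0 := by
  have hall : ∀ᵐ ω ∂Pr, ∀ k, ∃ n : ℕ, M ω (B k) = n :=
    ae_all_iff.2 fun k => hM.ae_exists_natCast (hB k)
      ((measure_mono (hanti (Nat.zero_le k))).trans_lt hfin)
  filter_upwards [hall] with ω hω
  have hlim := tendsto_measure_iInter_atTop (μ := M ω) (fun k => (hB k).nullMeasurableSet) hanti
    ⟨0, by obtain ⟨n, hn⟩ := hω 0; simp [hn]⟩
  rw [hempty, measure_empty] at hlim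
  obtain ⟨k, hk⟩ := (hlim.eventually (gt_mem_nhds zero_lt_one)).exists
  refine ⟨k, ?_⟩
  obtain ⟨n, hn⟩ := hω k
  simp only [Function.comp_apply, hn] at hk
  have : n = 0 := by
    have : n < 1 := by exact_mod_cast hk
    omega
  simp [hn, this]

end IsPoissonRandomMeasure

/-! ### Moment estimates for the intensity -/

lemma measurableSet_largeJumps (η : ℝ) : MeasurableSet (largeJumps η) :=
  measurableSet_lt measurable_const measurable_norm

lemma IsLevyMeasure.measure_largeJumps_lt_top {ν : Measure ℝ} (hν : IsLevyMeasure ν) {η : ℝ}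
    (hη : 0 < η) : ν (largeJumps η) < ∞ := by
  have hpos : 0 < min 1 (η ^ 2) := lt_min one_pos (by positivity)
  have h := mul_meas_ge_le_lintegral (μ := ν) (f := fun x => ENNReal.ofReal (min 1 (x ^ 2)))
    (by fun_prop) (ENNReal.ofReal (min 1 (η ^ 2)))
  have hsub : largeJumps η ⊆
      {x | ENNReal.ofReal (min 1 (η ^ 2)) ≤ ENNReal.ofReal (min 1 (x ^ 2))} := by
    intro x hx
    refine ENNReal.ofReal_le_ofReal (min_le_min le_rfl ?_)
    rw [← sq_abs x]
    exact pow_le_pow_left₀ hη.le (le_of_lt hx) 2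
  refine (measure_mono hsub).trans_lt ?_
  by_contra htop
  rw [not_lt, top_le_iff] at htop
  rw [htop, ENNReal.mul_top (ENNReal.ofReal_pos.2 hpos).ne'] at h
  exact absurd hν.lintegral_lt_top (not_lt.2 h)

variable {d : ℕ}

/-- The polynomially decaying weight `(1 + ‖t‖)⁻ᴺ`. -/
noncomputable def weight (N : ℕ) (t : EuclideanSpace ℝ (Fin d)) : ℝ := ((1 + ‖t‖) ^ N)⁻¹

lemma weight_pos (N : ℕ) (t : EuclideanSpace ℝ (Fin d)) : 0 < weight N t := by
  unfold weight; positivity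

@[fun_prop]
lemma continuous_weight (N : ℕ) : Continuous (weight (d := d) N) :=
  ((continuous_const.add continuous_norm).pow N).inv₀ fun t =>
    (pow_pos (by positivity : 0 < 1 + ‖t‖) N).ne'

@[fun_prop]
lemma measurable_weight (N : ℕ) : Measurable (weight (d := d) N) :=
  (continuous_weight N).measurable

lemma weight_eq_rpow (N : ℕ) (t : EuclideanSpace ℝ (Fin d)) :
    weight N t = (1 + ‖t‖) ^ (-(N : ℝ)) := by
  rw [weight, Real.rpow_neg (by positivity), Real.rpow_natCast]

lemma lintegral_weight_lt_top {N : ℕ} (hN : d < N) :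
    ∫⁻ t : EuclideanSpace ℝ (Fin d), ENNReal.ofReal (weight N t) < ∞ := by
  simp only [weight_eq_rpow]
  exact finite_integral_one_add_norm (by simpa using hN)

lemma lintegral_weight_intensity_lt_top {ν : Measure ℝ} (hν : IsLevyMeasure ν) {η : ℝ}
    (hη : 0 < η) {N : ℕ} (hN : d < N) :
    ∫⁻ p, ENNReal.ofReal (weight N p.2) ∂(intensity d η ν) < ∞ := by
  have h := lintegral_prod_mul (μ := ν.restrict (largeJumps η))
    (ν := (volume : Measure (EuclideanSpace ℝ (Fin d))).restrict (orthant d))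
    (f := fun _ => 1) (g := fun t => ENNReal.ofReal (weight N t)) (by fun_prop) (by fun_prop)
  simp only [one_mul, lintegral_one, Measure.restrict_apply_univ] at h
  rw [intensity, h]
  exact ENNReal.mul_lt_top (hν.measure_largeJumps_lt_top hη)
    ((setLIntegral_le_lintegral _ _).trans_lt (lintegral_weight_lt_top hN))

/-- Jumps that exceed `(1 + ‖t‖)ᴷ` at time `t` have finite intensity once `d < K α`, by Markov's
inequality for the moment of order `α`. -/
lemma intensity_jumps_gt_pow_lt_top {ν : Measure ℝ} {η α : ℝ} (hα : 0 < α)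
    (hmoment : ∫⁻ x in largeJumps η, ENNReal.ofReal (|x| ^ α) ∂ν < ∞) {K : ℕ}
    (hK : (d : ℝ) < K * α) :
    intensity d η ν {p | (1 + ‖p.2‖) ^ K < |p.1|} < ∞ := by
  have h := lintegral_prod_mul (μ := ν.restrict (largeJumps η))
    (ν := (volume : Measure (EuclideanSpace ℝ (Fin d))).restrict (orthant d))
    (f := fun x => ENNReal.ofReal (|x| ^ α))
    (g := fun t => ENNReal.ofReal ((1 + ‖t‖) ^ (-(K * α)))) (by fun_prop) (by fun_prop)
  have hfin : ∫⁻ p : ℝ × EuclideanSpace ℝ (Fin d), ENNReal.ofReal (|p.1| ^ α) *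
      ENNReal.ofReal ((1 + ‖p.2‖) ^ (-(K * α))) ∂(intensity d η ν) < ∞ := by
    rw [intensity, h]
    refine ENNReal.mul_lt_top hmoment ((setLIntegral_le_lintegral _ _).trans_lt ?_)
    exact finite_integral_one_add_norm (by simpa using hK)
  have hsub : {p : ℝ × EuclideanSpace ℝ (Fin d) | (1 + ‖p.2‖) ^ K < |p.1|} ⊆
      {p | 1 ≤ ENNReal.ofReal (|p.1| ^ α) * ENNReal.ofReal ((1 + ‖p.2‖) ^ (-(K * α)))} := by
    intro p hp
    have h1 : ((1 + ‖p.2‖) ^ K) ^ α ≤ |p.1| ^ α :=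
      Real.rpow_le_rpow (by positivity) (le_of_lt hp) hα.le
    rw [← Real.rpow_natCast, ← Real.rpow_mul (by positivity)] at h1
    have hpos : 0 < (1 + ‖p.2‖) ^ (K * α) := by positivity
    rw [Set.mem_ofPred_eq]
    rw [← ENNReal.ofReal_mul (by positivity), ENNReal.one_le_ofReal,
      Real.rpow_neg (by positivity), ← div_eq_mul_inv, one_le_div hpos]
    exact h1
  have hM := mul_meas_ge_le_lintegral (μ := intensity d η ν)
    (f := fun p => ENNReal.ofReal (|p.1| ^ α) * ENNReal.ofReal ((1 + ‖p.2‖) ^ (-(K * α))))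
    (by fun_prop) 1
  rw [one_mul] at hM
  exact (measure_mono hsub).trans_lt (hM.trans_lt hfin)

/-- For a suitable power `N`, almost every realization of the random measure integrates both
`(1 + ‖t‖)⁻ᴺ` and `|x| (1 + ‖t‖)⁻ᴺ`. -/
lemma ae_integrable_weight {Ω : Type*} [MeasurableSpace Ω] {Pr : Measure Ω}
    [IsProbabilityMeasure Pr] {ν : Measure ℝ} (hν : IsLevyMeasure ν) {η : ℝ} (hη : 0 < η) {α : ℝ}
    (hα : 0 < α) (hmoment : ∫⁻ x in largeJumps η, ENNReal.ofReal (|x| ^ α) ∂ν < ∞)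
    {M : Ω → Measure (ℝ × EuclideanSpace ℝ (Fin d))}
    (hM : IsPoissonRandomMeasure M (intensity d η ν) Pr) :
    ∃ N : ℕ, ∀ᵐ ω ∂Pr, Integrable (fun p => weight N p.2) (M ω) ∧
      Integrable (fun p => p.1 * weight N p.2) (M ω) := by
  obtain ⟨K, hK⟩ := exists_nat_gt ((d : ℝ) / α)
  rw [div_lt_iff₀ hα] at hK
  let B : ℕ → Set (ℝ × EuclideanSpace ℝ (Fin d)) := fun k =>
    {p | (1 + ‖p.2‖) ^ K < |p.1|} ∩ {p | (k : ℝ) < |p.1|}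
  have hB (k : ℕ) : MeasurableSet (B k) :=
    (measurableSet_lt (by fun_prop) (by fun_prop)).inter
      (measurableSet_lt (by fun_prop) (by fun_prop))
  have hanti : Antitone B := by
    intro j k hjk p hp
    exact ⟨hp.1, lt_of_le_of_lt (Nat.cast_le.2 hjk : (j : ℝ) ≤ k) hp.2⟩
  have hempty : ⋂ k, B k = ∅ := by
    ext p
    simp only [Set.mem_iInter, Set.mem_empty_iff_false, iff_false, not_forall]
    obtain ⟨k, hk⟩ := exists_nat_ge |p.1|
    exact ⟨k, fun hp => absurd hp.2 (not_lt.2 hk)⟩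
  have hB0 : intensity d η ν (B 0) < ∞ :=
    (measure_mono Set.inter_subset_left).trans_lt (intensity_jumps_gt_pow_lt_top hα hmoment hK)
  refine ⟨K + (d + 1), ?_⟩
  filter_upwards [hM.ae_exists_apply_eq_zero hB hanti hempty hB0,
    hM.ae_lintegral_lt_top (f := fun p => ENNReal.ofReal (weight (d + 1) p.2)) (by fun_prop)
      (lintegral_weight_intensity_lt_top hν hη (Nat.lt_succ_self d)).ne] with ω ⟨k, hk⟩ hw
  have hint : Integrable (fun p => weight (d + 1) p.2) (M ω) :=
    (lintegral_ofReal_ne_top_iff_integrable (by fun_prop)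
      (Filter.Eventually.of_forall fun p => (weight_pos _ _).le)).1 hw.ne
  have hsplit (p : ℝ × EuclideanSpace ℝ (Fin d)) :
      weight (K + (d + 1)) p.2 = ((1 + ‖p.2‖) ^ K)⁻¹ * weight (d + 1) p.2 := by
    simp only [weight, pow_add _ K, mul_inv]
  have hge (p : ℝ × EuclideanSpace ℝ (Fin d)) : 1 ≤ (1 + ‖p.2‖) ^ K :=
    one_le_pow₀ (by linarith [norm_nonneg p.2])
  constructor
  · refine hint.mono' (by fun_prop) (Filter.Eventually.of_forall fun p => ?_)
    rw [Real.norm_of_nonneg (weight_pos _ _).le, hsplit]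
    exact mul_le_of_le_one_left (weight_pos _ _).le (inv_le_one_of_one_le₀ (hge p))
  · refine (hint.const_mul ((k : ℝ) + 1)).mono' (by fun_prop) ?_
    have hnot : ∀ᵐ p ∂(M ω), p ∉ B k := measure_eq_zero_iff_ae_notMem.1 hk
    filter_upwards [hnot] with p hp
    -- outside `B k` the jump is at most `(1 + ‖t‖)ᴷ` or at most `k`
    have hjump : |p.1| ≤ (k + 1) * (1 + ‖p.2‖) ^ K := by
      have hk0 : (0 : ℝ) ≤ k := k.cast_nonneg
      by_cases h1 : (1 + ‖p.2‖) ^ K < |p.1|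
      · have h2 : |p.1| ≤ k := not_lt.1 fun h => hp ⟨h1, h⟩
        nlinarith [hge p]
      · nlinarith [hge p, not_lt.1 h1]
    have hpos : 0 < (1 + ‖p.2‖) ^ K := by positivity
    rw [norm_mul, Real.norm_of_nonneg (weight_pos _ _).le, Real.norm_eq_abs, hsplit, ← mul_assoc]
    refine mul_le_mul_of_nonneg_right ?_ (weight_pos _ _).le
    rw [← div_eq_mul_inv, div_le_iff₀ hpos]
    exact hjump

end LevySheet

namespace LevySheet

/-! ### Integrating the mixed derivative of a Schwartz function over an upper box -/

variable {d : ℕ}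

/-- The inclusion `y ↦ (0, y)` of `ℝᵈ` into `ℝᵈ⁺¹`. -/
noncomputable def succIncl (d : ℕ) :
    EuclideanSpace ℝ (Fin d) →ₗᵢ[ℝ] EuclideanSpace ℝ (Fin (d + 1)) where
  toFun y := WithLp.toLp 2 (Fin.cons (α := fun _ => ℝ) 0 y.ofLp)
  map_add' x y := by
    ext i
    refine Fin.cases ?_ (fun j => ?_) i <;> simp
  map_smul' c x := by
    ext i
    refine Fin.cases ?_ (fun j => ?_) i <;> simp
  norm_map' x := by
    simp [EuclideanSpace.norm_eq, Fin.sum_univ_succ]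

/-- The point `(a, y)` of `ℝᵈ⁺¹`. -/
noncomputable def consPoint (a : ℝ) (y : EuclideanSpace ℝ (Fin d)) :
    EuclideanSpace ℝ (Fin (d + 1)) :=
  a • EuclideanSpace.single 0 1 + succIncl d y

@[simp] lemma consPoint_zero (a : ℝ) (y : EuclideanSpace ℝ (Fin d)) : consPoint a y 0 = a := by
  simp [consPoint, succIncl]

@[simp] lemma consPoint_succ (a : ℝ) (y : EuclideanSpace ℝ (Fin d)) (i : Fin d) :
    consPoint a y i.succ = y i := by
  simp [consPoint, succIncl]

lemma succIncl_single (i : Fin d) :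
    succIncl d (EuclideanSpace.single i 1) = EuclideanSpace.single i.succ 1 := by
  ext j
  refine Fin.cases ?_ (fun k => ?_) j
  · simp [succIncl]
  · simp [succIncl, Pi.single_apply]

/-- `(a, y) ↦ consPoint a y` as a measurable equivalence. -/
noncomputable def consEquiv (d : ℕ) :
    ℝ × EuclideanSpace ℝ (Fin d) ≃ᵐ EuclideanSpace ℝ (Fin (d + 1)) :=
  (((MeasurableEquiv.refl ℝ).prodCongr (MeasurableEquiv.toLp 2 (Fin d → ℝ)).symm).trans
    (MeasurableEquiv.piFinSuccAbove (fun _ : Fin (d + 1) => ℝ) 0).symm).trans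
    (MeasurableEquiv.toLp 2 (Fin (d + 1) → ℝ))

lemma consEquiv_apply (p : ℝ × EuclideanSpace ℝ (Fin d)) :
    consEquiv d p = consPoint p.1 p.2 := by
  ext i
  refine Fin.cases ?_ (fun j => ?_) i
  · rw [consPoint_zero]; rfl
  · rw [consPoint_succ]; rfl

lemma measurePreserving_consEquiv : MeasurePreserving (consEquiv d) volume volume :=
  (PiLp.volume_preserving_toLp (Fin (d + 1))).comp
    (((volume_preserving_piFinSuccAbove (fun _ : Fin (d + 1) => ℝ) 0).symm _).comp
      ((MeasurePreserving.id volume).prod (PiLp.volume_preserving_ofLp (Fin d))))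

lemma hasTemperateGrowth_consPoint_left (y : EuclideanSpace ℝ (Fin d)) :
    Function.HasTemperateGrowth fun a : ℝ => consPoint a y :=
  ((ContinuousLinearMap.toSpanSingleton ℝ
    (EuclideanSpace.single (0 : Fin (d + 1)) (1 : ℝ))).hasTemperateGrowth).add
    (Function.HasTemperateGrowth.const (succIncl d y))

lemma hasTemperateGrowth_consPoint_right (a : ℝ) :
    Function.HasTemperateGrowth (consPoint (d := d) a) :=
  (Function.HasTemperateGrowth.const (a • EuclideanSpace.single (0 : Fin (d + 1)) (1 : ℝ))).add
    (succIncl d).toContinuousLinearMap.hasTemperateGrowth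

lemma isometry_consPoint_left (y : EuclideanSpace ℝ (Fin d)) :
    Isometry fun a : ℝ => consPoint a y := by
  refine Isometry.of_dist_eq fun a b => ?_
  simp [consPoint, dist_eq_norm, ← sub_smul, norm_smul]

lemma isometry_consPoint_right (a : ℝ) : Isometry (consPoint (d := d) a) := by
  refine Isometry.of_dist_eq fun x y => ?_
  simp [consPoint, (succIncl d).isometry.dist_eq]

/-- The restriction of a Schwartz function to the line `{(a, y) | a ∈ ℝ}`. -/
noncomputable def lineSlice (y : EuclideanSpace ℝ (Fin d))
    (f : 𝓢(EuclideanSpace ℝ (Fin (d + 1)), ℝ)) : 𝓢(ℝ, ℝ) :=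
  SchwartzMap.compCLMOfAntilipschitz ℝ (hasTemperateGrowth_consPoint_left y)
    (isometry_consPoint_left y).antilipschitz f

/-- The restriction of a Schwartz function to the hyperplane `{(a, y) | y ∈ ℝᵈ}`. -/
noncomputable def slice (a : ℝ) (f : 𝓢(EuclideanSpace ℝ (Fin (d + 1)), ℝ)) :
    𝓢(EuclideanSpace ℝ (Fin d), ℝ) :=
  SchwartzMap.compCLMOfAntilipschitz ℝ (hasTemperateGrowth_consPoint_right a)
    (isometry_consPoint_right a).antilipschitz f

@[simp] lemma lineSlice_apply (y : EuclideanSpace ℝ (Fin d))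
    (f : 𝓢(EuclideanSpace ℝ (Fin (d + 1)), ℝ)) (a : ℝ) :
    lineSlice y f a = f (consPoint a y) := rfl

@[simp] lemma slice_apply (a : ℝ) (f : 𝓢(EuclideanSpace ℝ (Fin (d + 1)), ℝ))
    (y : EuclideanSpace ℝ (Fin d)) : slice a f y = f (consPoint a y) := rfl

/-- The partial derivative with respect to the first coordinate. -/
noncomputable def firstDeriv (f : 𝓢(EuclideanSpace ℝ (Fin (d + 1)), ℝ)) :
    𝓢(EuclideanSpace ℝ (Fin (d + 1)), ℝ) :=
  ∂_{EuclideanSpace.single (0 : Fin (d + 1)) (1 : ℝ)} f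

lemma hasDerivAt_lineSlice (y : EuclideanSpace ℝ (Fin d))
    (f : 𝓢(EuclideanSpace ℝ (Fin (d + 1)), ℝ)) (a : ℝ) :
    HasDerivAt (lineSlice y f) (lineSlice y (firstDeriv f) a) a := by
  have h : HasDerivAt (fun a : ℝ => consPoint a y) (EuclideanSpace.single 0 1) a := by
    simpa [consPoint] using ((hasDerivAt_id a).smul_const
      (EuclideanSpace.single (0 : Fin (d + 1)) (1 : ℝ))).add_const (succIncl d y)
  exact (f.hasFDerivAt (consPoint a y)).comp_hasDerivAt a h

lemma lineDerivOp_slice (a : ℝ) (f : 𝓢(EuclideanSpace ℝ (Fin (d + 1)), ℝ))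
    (v : EuclideanSpace ℝ (Fin d)) : ∂_{v} (slice a f) = slice a (∂_{succIncl d v} f) := by
  ext y
  have h : HasFDerivAt (consPoint (d := d) a) (succIncl d).toContinuousLinearMap y :=
    (succIncl d).toContinuousLinearMap.hasFDerivAt.const_add _
  have h2 := (f.hasFDerivAt (consPoint a y)).comp y h
  rw [SchwartzMap.lineDerivOp_apply_eq_fderiv]
  exact congrArg (fun L => L v) h2.fderiv

lemma iteratedLineDerivOp_slice (a : ℝ) (f : 𝓢(EuclideanSpace ℝ (Fin (d + 1)), ℝ)) {n : ℕ}
    (m : Fin n → EuclideanSpace ℝ (Fin d)) :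
    ∂^{m} (slice a f) = slice a (∂^{fun i => succIncl d (m i)} f) := by
  induction n with
  | zero => rfl
  | succ n ih =>
    rw [LineDeriv.iteratedLineDerivOp_succ_left, ih, lineDerivOp_slice,
      LineDeriv.iteratedLineDerivOp_succ_left]
    rfl

lemma setIntegral_Ici_lineSlice (y : EuclideanSpace ℝ (Fin d))
    (f : 𝓢(EuclideanSpace ℝ (Fin (d + 1)), ℝ)) (a : ℝ) :
    ∫ b in Set.Ici a, (firstDeriv f) (consPoint b y)
      = -f (consPoint a y) := by
  rw [integral_Ici_eq_integral_Ioi]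
  have h := integral_Ioi_of_hasDerivAt_of_tendsto (a := a) (m := 0)
    (lineSlice y f).continuous.continuousWithinAt
    (fun b _ => hasDerivAt_lineSlice y f b) (SchwartzMap.integrable _).integrableOn
    ((lineSlice y f).tendsto_cocompact.mono_left atTop_le_cocompact)
  simpa using h

/-- The fundamental theorem of calculus in each of the `d` coordinates. -/
theorem setIntegral_upperBox_mixed (φ : 𝓢(EuclideanSpace ℝ (Fin d), ℝ))
    (t : EuclideanSpace ℝ (Fin d)) :
    ∫ s in upperBox t, (∂^{fun i : Fin d => EuclideanSpace.single i (1 : ℝ)} φ) s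
      = (-1) ^ d * φ t := by
  induction d with
  | zero =>
    have hbox : upperBox t = Set.univ := Set.eq_univ_of_forall fun s i => i.elim0
    rw [hbox, Measure.restrict_univ, volume_euclideanSpace_eq_dirac, integral_dirac]
    simp [Subsingleton.elim t 0]
  | succ d ih =>
    set t' : EuclideanSpace ℝ (Fin d) := WithLp.toLp 2 fun i => t i.succ with ht'
    have ht : consPoint (t 0) t' = t := by
      ext i
      refine Fin.cases ?_ (fun j => ?_) i <;> simp [ht']
    set G := ∂^{fun i : Fin d => (EuclideanSpace.single i.succ (1 : ℝ) :
      EuclideanSpace ℝ (Fin (d + 1)))} φ with hG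
    have hpre : consEquiv d ⁻¹' upperBox t = Set.Ici (t 0) ×ˢ upperBox t' := by
      ext p
      simp [upperBox, consEquiv_apply, Fin.forall_fin_succ, ht']
    have hint : IntegrableOn (fun p => (firstDeriv G) (consEquiv d p))
        (Set.Ici (t 0) ×ˢ upperBox t') ((volume : Measure ℝ).prod volume) :=
      ((measurePreserving_consEquiv.integrable_comp_emb (consEquiv d).measurableEmbedding).2
        (SchwartzMap.integrable _)).integrableOn
    have hslice (y : EuclideanSpace ℝ (Fin d)) : G (consPoint (t 0) y)
        = (∂^{fun i : Fin d => EuclideanSpace.single i (1 : ℝ)} (slice (t 0) φ)) y := by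
      rw [iteratedLineDerivOp_slice]
      simp only [succIncl_single, slice_apply, hG]
    have hint' := hint
    rw [IntegrableOn, ← Measure.prod_restrict] at hint'
    calc ∫ s in upperBox t, (firstDeriv G) s
        = ∫ p in Set.Ici (t 0) ×ˢ upperBox t',
            (firstDeriv G) (consEquiv d p) := by
          rw [← hpre, measurePreserving_consEquiv.setIntegral_preimage_emb
            (consEquiv d).measurableEmbedding]
      _ = ∫ b in Set.Ici (t 0), ∫ y in upperBox t',
            (firstDeriv G) (consEquiv d (b, y)) :=
          setIntegral_prod _ hint
      _ = ∫ y in upperBox t', ∫ b in Set.Ici (t 0),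
            (firstDeriv G) (consEquiv d (b, y)) :=
          integral_integral_swap hint'
      _ = ∫ y in upperBox t', -G (consPoint (t 0) y) := by
          simp only [consEquiv_apply, setIntegral_Ici_lineSlice]
      _ = (-1) ^ (d + 1) * φ t := by
          simp only [integral_neg, hslice, ih, slice_apply, ht]
          ring

end LevySheet

namespace LevySheet

/-! ### Tempered distributions given by integrals -/

variable {d : ℕ}

lemma exists_norm_le_seminorm_mul_weight (d N : ℕ) :
    ∃ (s : Finset (ℕ × ℕ)) (C : ℝ), 0 ≤ C ∧
      ∀ (φ : 𝓢(EuclideanSpace ℝ (Fin d), ℝ)) (t : EuclideanSpace ℝ (Fin d)),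
        ‖φ t‖ ≤ C * s.sup (schwartzSeminormFamily ℝ (EuclideanSpace ℝ (Fin d)) ℝ) φ *
          weight N t := by
  refine ⟨Finset.Iic (N, 0), 2 ^ N, by positivity, fun φ t => ?_⟩
  have h := SchwartzMap.one_add_le_sup_seminorm_apply (𝕜 := ℝ) (m := (N, 0)) (k := N) (n := 0)
    le_rfl le_rfl φ t
  rw [norm_iteratedFDeriv_zero] at h
  rw [weight, ← div_eq_mul_inv, le_div_iff₀ (by positivity), mul_comm]
  exact h

/-- A signed density `g` transported by `τ` defines a tempered distribution
`φ ↦ ∫ φ (τ p) g p m(dp)` as soon as it is integrable against a polynomially decaying weight. -/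
theorem exists_tempered_integral {X : Type*} [MeasurableSpace X] {m : Measure X}
    {τ : X → EuclideanSpace ℝ (Fin d)} (hτ : Measurable τ) {g : X → ℝ} {N : ℕ}
    (hg : Integrable (fun p => g p * weight N (τ p)) m) :
    ∃ T : Tempered d, ∀ φ : 𝓢(EuclideanSpace ℝ (Fin d), ℝ),
      Integrable (fun p => φ (τ p) * g p) m ∧ T φ = ∫ p, φ (τ p) * g p ∂m := by
  obtain ⟨s, C, hC, hbound⟩ := exists_norm_le_seminorm_mul_weight d N
  have hle (φ : 𝓢(EuclideanSpace ℝ (Fin d), ℝ)) (p : X) : ‖φ (τ p) * g p‖ ≤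
      C * s.sup (schwartzSeminormFamily ℝ (EuclideanSpace ℝ (Fin d)) ℝ) φ *
        ‖g p * weight N (τ p)‖ := by
    rw [norm_mul, norm_mul, Real.norm_of_nonneg (weight_pos N (τ p)).le]
    calc _ ≤ _ := mul_le_mul_of_nonneg_right (hbound φ (τ p)) (norm_nonneg (g p))
      _ = _ := by ring
  have hmeas : AEStronglyMeasurable g m := by
    have h := hg.aestronglyMeasurable.mul
      (((measurable_weight N).comp hτ).inv.aestronglyMeasurable (μ := m))
    refine h.congr (Filter.Eventually.of_forall fun p => ?_)
    simp [mul_assoc, mul_inv_cancel₀ (weight_pos N (τ p)).ne']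
  have hint (φ : 𝓢(EuclideanSpace ℝ (Fin d), ℝ)) : Integrable (fun p => φ (τ p) * g p) m :=
    (hg.norm.const_mul _).mono'
      ((φ.continuous.measurable.comp hτ).aestronglyMeasurable.mul hmeas)
      (Filter.Eventually.of_forall (hle φ))
  refine ⟨SchwartzMap.mkCLMtoNormedSpace (σ := RingHom.id ℝ) (fun φ => ∫ p, φ (τ p) * g p ∂m)
    (fun φ ψ => ?_) (fun a φ => ?_)
    ⟨s, C * ∫ p, ‖g p * weight N (τ p)‖ ∂m, by positivity, fun φ => ?_⟩, fun φ => ⟨hint φ, rfl⟩⟩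
  · rw [← integral_add (hint φ) (hint ψ)]
    simp [add_mul]
  · simp [mul_assoc, integral_const_mul]
  · refine (norm_integral_le_of_norm_le (hg.norm.const_mul _)
      (Filter.Eventually.of_forall (hle φ))).trans_eq ?_
    rw [integral_const_mul]
    ring

lemma integrable_weight {N : ℕ} (hN : d < N) :
    Integrable (weight N : EuclideanSpace ℝ (Fin d) → ℝ) :=
  (lintegral_ofReal_ne_top_iff_integrable (by fun_prop)
    (Filter.Eventually.of_forall fun t => (weight_pos N t).le)).1 (lintegral_weight_lt_top hN).ne

lemma weight_add (N K : ℕ) (t : EuclideanSpace ℝ (Fin d)) :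
    weight (N + K) t = weight N t * weight K t := by
  simp only [weight, pow_add, mul_inv]

lemma integrable_schwartz_mul_weight_inv (φ : 𝓢(EuclideanSpace ℝ (Fin d), ℝ)) (N : ℕ) :
    Integrable (fun t => φ t * (weight N t)⁻¹) := by
  have h : Integrable (fun t : EuclideanSpace ℝ (Fin d) =>
      (weight N t)⁻¹ * weight (N + (d + 1)) t) := by
    refine (integrable_weight (Nat.lt_succ_self d)).congr
      (Filter.Eventually.of_forall fun t => ?_)
    simp only [weight_add N (d + 1) t, inv_mul_cancel_left₀ (weight_pos N t).ne']
  obtain ⟨T, hT⟩ := exists_tempered_integral (τ := fun t => t) measurable_id h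
  exact (hT φ).1

/-! ### The sheet of a point configuration -/

section Deterministic

variable {m : Measure (ℝ × EuclideanSpace ℝ (Fin d))} {N : ℕ} {η : ℝ}

lemma sFinite_of_integrable_weight (hw : Integrable (fun p => weight N p.2) m) : SFinite m := by
  set f : ℝ × EuclideanSpace ℝ (Fin d) → ℝ≥0∞ := fun p => ENNReal.ofReal (weight N p.2)
  have hfin : IsFiniteMeasure (m.withDensity f) := isFiniteMeasure_withDensity_ofReal hw.2
  have h := withDensity_inv_same (μ := m) (f := f) (by fun_prop)
    (Filter.Eventually.of_forall fun p => (ENNReal.ofReal_pos.2 (weight_pos N p.2)).ne')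
    (Filter.Eventually.of_forall fun p => ENNReal.ofReal_ne_top)
  rw [← h]
  infer_instance

lemma measurableSet_le_apply {X : Type*} [MeasurableSpace X]
    {f g : X → EuclideanSpace ℝ (Fin d)} (hf : Measurable f) (hg : Measurable g) :
    MeasurableSet {x | ∀ i, f x i ≤ g x i} := by
  simp only [Set.ofPred_forall]
  exact MeasurableSet.iInter fun i => measurableSet_le (by fun_prop) (by fun_prop)

lemma measurableSet_orthant : MeasurableSet (orthant d) := by
  simpa [orthant] using measurableSet_le_apply (d := d)
    (f := fun _ => 0) (g := fun t => t) measurable_const measurable_id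

lemma measurableSet_upperBox (t : EuclideanSpace ℝ (Fin d)) : MeasurableSet (upperBox t) :=
  measurableSet_le_apply measurable_const measurable_id

/-- The pairs `(t, (x, s))` such that the point `(x, s)` contributes to the sheet at time `t`. -/
def sheetGraph (d : ℕ) (η : ℝ) :
    Set (EuclideanSpace ℝ (Fin d) × ℝ × EuclideanSpace ℝ (Fin d)) :=
  {z | z.2 ∈ largeJumps η ×ˢ boxTo z.1}

lemma measurableSet_sheetGraph : MeasurableSet (sheetGraph d η) := by
  have h : sheetGraph d η = {z | z.2.1 ∈ largeJumps η} ∩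
      ({z | z.2.2 ∈ orthant d} ∩ {z | ∀ i, z.2.2 i ≤ z.1 i}) := by
    ext z
    simp [sheetGraph, boxTo, orthant, forall_and]
  rw [h]
  exact ((measurableSet_largeJumps η).preimage (by fun_prop)).inter
    ((measurableSet_orthant.preimage (by fun_prop)).inter
      (measurableSet_le_apply (by fun_prop) (by fun_prop)))

lemma measurableSet_largeJumps_prod_boxTo (t : EuclideanSpace ℝ (Fin d)) :
    MeasurableSet (largeJumps η ×ˢ boxTo t) :=
  measurableSet_sheetGraph.preimage (measurable_prodMk_left (x := t))

lemma norm_le_of_mem_boxTo {s t : EuclideanSpace ℝ (Fin d)} (hs : s ∈ boxTo t) : ‖s‖ ≤ ‖t‖ := by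
  rw [EuclideanSpace.norm_eq, EuclideanSpace.norm_eq]
  refine Real.sqrt_le_sqrt (Finset.sum_le_sum fun i _ => ?_)
  rw [Real.norm_of_nonneg (hs i).1, Real.norm_of_nonneg ((hs i).1.trans (hs i).2)]
  exact pow_le_pow_left₀ (hs i).1 (hs i).2 2

lemma weight_le_of_mem_boxTo {s t : EuclideanSpace ℝ (Fin d)} (hs : s ∈ boxTo t) (N : ℕ) :
    weight N t ≤ weight N s := by
  have := norm_le_of_mem_boxTo hs
  unfold weight
  gcongr

/-- On the box `[0, t]` the weight at `s` dominates the weight at `t`. -/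
lemma norm_indicator_sheetGraph_le (t : EuclideanSpace ℝ (Fin d))
    (p : ℝ × EuclideanSpace ℝ (Fin d)) :
    ‖(sheetGraph d η).indicator (fun z => z.2.1) (t, p)‖ ≤
      (weight N t)⁻¹ * ‖p.1 * weight N p.2‖ := by
  by_cases hz : (t, p) ∈ sheetGraph d η
  · rw [Set.indicator_of_mem hz, norm_mul, Real.norm_of_nonneg (weight_pos N p.2).le,
      ← div_eq_inv_mul, le_div_iff₀ (weight_pos N t)]
    exact mul_le_mul_of_nonneg_left (weight_le_of_mem_boxTo hz.2 N) (norm_nonneg _)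
  · rw [Set.indicator_of_notMem hz, norm_zero]
    have := weight_pos N t
    positivity

lemma indicator_sheetGraph (t : EuclideanSpace ℝ (Fin d)) :
    (fun p => (sheetGraph d η).indicator (fun z => z.2.1) (t, p)) =
      (largeJumps η ×ˢ boxTo t).indicator (fun p => p.1) := rfl

lemma measurable_indicator_sheetGraph :
    Measurable ((sheetGraph d η).indicator fun z => z.2.1) :=
  Measurable.indicator (by fun_prop) measurableSet_sheetGraph

lemma sheet_eq_integral_indicator (t : EuclideanSpace ℝ (Fin d)) :
    sheet η m t = ∫ p, (sheetGraph d η).indicator (fun z => z.2.1) (t, p) ∂m := by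
  rw [indicator_sheetGraph, integral_indicator (measurableSet_largeJumps_prod_boxTo t), sheet]

lemma integrableOn_largeJumps_prod_boxTo (hx : Integrable (fun p => p.1 * weight N p.2) m)
    (t : EuclideanSpace ℝ (Fin d)) :
    IntegrableOn (fun p => p.1) (largeJumps η ×ˢ boxTo t) m := by
  rw [← integrable_indicator_iff (measurableSet_largeJumps_prod_boxTo t), ← indicator_sheetGraph]
  exact (hx.norm.const_mul _).mono'
    (measurable_indicator_sheetGraph.comp measurable_prodMk_left).aestronglyMeasurable
    (Filter.Eventually.of_forall (norm_indicator_sheetGraph_le t))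

lemma norm_sheet_le (hx : Integrable (fun p => p.1 * weight N p.2) m)
    (t : EuclideanSpace ℝ (Fin d)) :
    ‖sheet η m t‖ ≤ (weight N t)⁻¹ * ∫ p, ‖p.1 * weight N p.2‖ ∂m := by
  rw [sheet_eq_integral_indicator, ← integral_const_mul]
  exact norm_integral_le_of_norm_le (hx.norm.const_mul _)
    (Filter.Eventually.of_forall (norm_indicator_sheetGraph_le t))

lemma stronglyMeasurable_sheet [SFinite m] : StronglyMeasurable (sheet η m) := by
  have h : sheet η m =
      fun t => ∫ p, (sheetGraph d η).indicator (fun z => z.2.1) (t, p) ∂m :=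
    funext sheet_eq_integral_indicator
  rw [h]
  exact measurable_indicator_sheetGraph.stronglyMeasurable.integral_prod_right'

lemma integrable_sheet_mul_weight [SFinite m]
    (hx : Integrable (fun p => p.1 * weight N p.2) m) :
    Integrable (fun t => sheet η m t * weight (N + (d + 1)) t) := by
  refine ((integrable_weight (Nat.lt_succ_self d)).const_mul
    (∫ p, ‖p.1 * weight N p.2‖ ∂m)).mono'
    (stronglyMeasurable_sheet.aestronglyMeasurable.mul
      (continuous_weight _).aestronglyMeasurable)
    (Filter.Eventually.of_forall fun t => ?_)
  rw [norm_mul, Real.norm_of_nonneg (weight_pos _ t).le, weight_add, ← mul_assoc]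
  refine mul_le_mul_of_nonneg_right ?_ (weight_pos _ t).le
  rw [← le_div_iff₀ (weight_pos N t), div_eq_inv_mul]
  exact norm_sheet_le hx t

lemma integrable_indicator_sheetGraph_mul [SFinite m]
    (hx : Integrable (fun p => p.1 * weight N p.2) m)
    (φ : 𝓢(EuclideanSpace ℝ (Fin d), ℝ)) :
    Integrable (fun z : EuclideanSpace ℝ (Fin d) × ℝ × EuclideanSpace ℝ (Fin d) =>
      (sheetGraph d η).indicator (fun z => z.2.1) z * φ z.1)
      ((volume.restrict (orthant d)).prod m) := by
  refine ((integrable_schwartz_mul_weight_inv φ N).norm.integrableOn.mul_prod hx.norm).mono'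
    (measurable_indicator_sheetGraph.mul
      (φ.continuous.measurable.comp measurable_fst)).aestronglyMeasurable
    (Filter.Eventually.of_forall fun z => ?_)
  have h := mul_le_mul_of_nonneg_right
    (norm_indicator_sheetGraph_le (η := η) (N := N) z.1 z.2) (norm_nonneg (φ z.1))
  rw [norm_mul]
  refine h.trans_eq ?_
  rw [norm_mul (φ z.1), norm_inv, Real.norm_of_nonneg (weight_pos N z.1).le]
  ring

/-- For a fixed point `(x, s)`, the times `t` with `s ∈ [0, t]` fill the upper box `[s, +∞[`. -/
lemma setIntegral_orthant_indicator_sheetGraph (φ : 𝓢(EuclideanSpace ℝ (Fin d), ℝ))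
    (p : ℝ × EuclideanSpace ℝ (Fin d)) :
    ∫ t in orthant d, (sheetGraph d η).indicator (fun z => z.2.1) (t, p) * φ t =
      (largeJumps η ×ˢ orthant d).indicator
        (fun p => (∫ s in upperBox p.2, φ s) * p.1) p := by
  by_cases hp : p ∈ largeJumps η ×ˢ orthant d
  · have hfun : (fun t => (sheetGraph d η).indicator (fun z => z.2.1) (t, p) * φ t) =
        (upperBox p.2).indicator (fun t => p.1 * φ t) := by
      funext t
      have hiff : (t, p) ∈ sheetGraph d η ↔ t ∈ upperBox p.2 :=
        ⟨fun h i => (h.2 i).2, fun h => ⟨hp.1, fun i => ⟨hp.2 i, h i⟩⟩⟩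
      by_cases ht : t ∈ upperBox p.2
      · rw [Set.indicator_of_mem ht, Set.indicator_of_mem (hiff.2 ht)]
      · rw [Set.indicator_of_notMem ht, Set.indicator_of_notMem (fun h => ht (hiff.1 h)), zero_mul]
    have hsub : upperBox p.2 ⊆ orthant d := fun t ht i => (hp.2 i).trans (ht i)
    rw [hfun, setIntegral_indicator (measurableSet_upperBox p.2),
      Set.inter_eq_self_of_subset_right hsub, integral_const_mul, Set.indicator_of_mem hp, mul_comm]
  · have hfun (t : EuclideanSpace ℝ (Fin d)) : (t, p) ∉ sheetGraph d η :=
      fun h => hp ⟨h.1, fun i => (h.2 i).1⟩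
    simp [Set.indicator_of_notMem (hfun _), Set.indicator_of_notMem hp]

/-- Fubini's theorem for the pairing of the sheet with a test function. -/
theorem integral_sheet_mul [SFinite m] (hx : Integrable (fun p => p.1 * weight N p.2) m)
    (φ : 𝓢(EuclideanSpace ℝ (Fin d), ℝ)) :
    IntegrableOn (fun p => (∫ s in upperBox p.2, φ s) * p.1) (largeJumps η ×ˢ orthant d) m ∧
    ∫ t in orthant d, sheet η m t * φ t =
      ∫ p in largeJumps η ×ˢ orthant d, (∫ s in upperBox p.2, φ s) * p.1 ∂m := by
  have hS : MeasurableSet (largeJumps η ×ˢ orthant d) :=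
    (measurableSet_largeJumps η).prod measurableSet_orthant
  have hint := integrable_indicator_sheetGraph_mul (η := η) hx φ
  constructor
  · rw [← integrable_indicator_iff hS]
    refine hint.integral_prod_right.congr (Filter.Eventually.of_forall fun p => ?_)
    exact setIntegral_orthant_indicator_sheetGraph φ p
  · have hsheet (t : EuclideanSpace ℝ (Fin d)) : sheet η m t * φ t =
        ∫ p, (sheetGraph d η).indicator (fun z => z.2.1) (t, p) * φ t ∂m := by
      rw [sheet_eq_integral_indicator, integral_mul_const]
    simp only [hsheet]
    rw [integral_integral_swap hint, ← integral_indicator hS]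
    simp only [setIntegral_orthant_indicator_sheetGraph]

end Deterministic

end LevySheet

theorem lemma3p8 {Ω : Type*} [MeasurableSpace Ω] (Pr : Measure Ω) [IsProbabilityMeasure Pr]
    (d : ℕ) (hd : 1 ≤ d) (ν : Measure ℝ) (hν : LevySheet.IsLevyMeasure ν)
    (η : ℝ) (hη : 0 < η) (α : ℝ) (hα : 0 < α)
    (hmoment : ∫⁻ x in LevySheet.largeJumps η, ENNReal.ofReal (|x| ^ α) ∂ν < ∞)
    (M : Ω → Measure (ℝ × EuclideanSpace ℝ (Fin d)))
    (hM : LevySheet.IsPoissonRandomMeasure M (LevySheet.intensity d η ν) Pr) :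
    ∀ᵐ ω ∂Pr,
      -- the integrals that define the sheet converge
      (∀ t ∈ LevySheet.orthant d, IntegrableOn (fun p => p.1)
        (LevySheet.largeJumps η ×ˢ LevySheet.boxTo t) (M ω)) ∧
      ∃ TM TP : LevySheet.Tempered d,
        -- (i) `M` is the tempered distribution `TM`
        (∀ φ : 𝓢(EuclideanSpace ℝ (Fin d), ℝ),
          IntegrableOn (fun p => φ p.2 * p.1)
            (LevySheet.largeJumps η ×ˢ LevySheet.orthant d) (M ω) ∧
          TM φ = ∫ p in LevySheet.largeJumps η ×ˢ LevySheet.orthant d, φ p.2 * p.1 ∂(M ω)) ∧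
        -- (ii) `P` is the tempered distribution `TP`
        (∀ φ : 𝓢(EuclideanSpace ℝ (Fin d), ℝ),
          IntegrableOn (fun t => LevySheet.sheet η (M ω) t * φ t) (LevySheet.orthant d) volume ∧
          TP φ = ∫ t in LevySheet.orthant d, LevySheet.sheet η (M ω) t * φ t) ∧
        -- (ii) the integral formula for `⟨P, φ⟩`
        (∀ φ : 𝓢(EuclideanSpace ℝ (Fin d), ℝ),
          IntegrableOn (fun p => (∫ s in LevySheet.upperBox p.2, φ s) * p.1)
            (LevySheet.largeJumps η ×ˢ LevySheet.orthant d) (M ω) ∧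
          TP φ = ∫ p in LevySheet.largeJumps η ×ˢ LevySheet.orthant d,
            (∫ s in LevySheet.upperBox p.2, φ s) * p.1 ∂(M ω)) ∧
        -- (iii) `M = ∂ᵈP/∂t₁⋯∂t_d`
        TM = LevySheet.mixedDeriv TP := by

  obtain ⟨N, hN⟩ := LevySheet.ae_integrable_weight hν hη hα hmoment hM
  filter_upwards [hN] with ω ⟨hw, hx⟩
  have hfin : SFinite (M ω) := LevySheet.sFinite_of_integrable_weight hw
  obtain ⟨TM, hTM⟩ := LevySheet.exists_tempered_integral measurable_snd
    (hx.integrableOn (s := LevySheet.largeJumps η ×ˢ LevySheet.orthant d))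
  obtain ⟨TP, hTP⟩ := LevySheet.exists_tempered_integral measurable_id
    ((LevySheet.integrable_sheet_mul_weight (η := η) hx).integrableOn
      (s := LevySheet.orthant d))
  simp only [id_eq, mul_comm (_ : ℝ) (LevySheet.sheet η (M ω) _)] at hTP
  have hfub (φ : 𝓢(EuclideanSpace ℝ (Fin d), ℝ)) :=
    LevySheet.integral_sheet_mul (η := η) hx φ
  refine ⟨fun t _ => LevySheet.integrableOn_largeJumps_prod_boxTo hx t, TM, TP, hTM, hTP,
    fun φ => ⟨(hfub φ).1, (hTP φ).2.trans (hfub φ).2⟩, ?_⟩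
  ext φ
  have hsign : (-1 : ℝ) ^ d * (-1) ^ d = 1 := by rw [← mul_pow]; simp
  simp only [LevySheet.mixedDeriv, smul_apply, ContinuousLinearMap.comp_apply,
    LineDeriv.iteratedLineDerivOpCLM_apply, (hTP _).2, (hfub _).2, (hTM φ).2,
    LevySheet.setIntegral_upperBox_mixed, mul_assoc, integral_const_mul, smul_eq_mul]
  rw [← mul_assoc, hsign, one_mul]
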